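/- Let $\rho$ be a measure on $\mathbb{R}$ and $h\ge 0$ a measurable function such that $h\,\rho$ is not concentrated on a single point. Let $\Theta=\{\theta\in\mathbb{R}:\int h(x)e^{x\theta}\,\rho(dx)<\infty\}$, and for $\theta\in\Theta$ let $P_\theta$ be the probability distribution with density $p(x,\theta)=h(x)e^{x\theta-A(\theta)}$ with respect to $\rho$, where $A(\theta)=\log\int h(x)e^{x\theta}\rho(dx)$. Write $\mu(\theta)$ for the mean of $P_\theta$ and $D(\theta,\theta')$ for the Kullback–Leibler divergence of $P_\theta$ from $P_{\theta'}$, with $1/\infty=0$. Let $\pi$ be a (possibly randomized) two-armed bandit algorithm, which chooses the arm of each round on the basis of the arms played and the rewards received in the previous rounds. For an environment $\nu=(\theta_1,\theta_2)\in\Theta^2$ (each play of arm $k$ yields an independent reward with distribution $P_{\theta_k}$), let $\mathbb{P}_{\nu\pi}$ and $\mathbb{E}_{\nu\pi}$ be the probability and the expectation induced by $\pi$ interacting with $\nu$. Let $N_k(T)$ be the number of plays of arm $k$ in the first $T$ rounds, and $\widehat\mu_k(T)$ the average of the rewards received from these plays. Assume that $\pi$ is invariant under permutation of the arm labels: in the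 environment $(\theta_2,\theta_1)$ it behaves, in law, as in $(\theta_1,\theta_2)$ with the arm labels swapped, for all $\theta_1,\theta_2\in\Theta$. Assume moreover that (A1) for every environment $\nu=(\theta_1,\theta_2)$ with $\theta_1>\theta_2$, $$\lim_{T\to\infty}\frac{\mathbb{E}_{\nu\pi}[N_2(T)]}{\log T}=\frac{1}{D(\theta_2,\theta_1)} .$$ Then for every environment $\nu=(\theta_1,\theta_2)$ with $\theta_1>\theta_2$ such that $\theta_2$ is not the smallest element of $\Theta$, and for all $\gamma\in(0,1)$ and $\epsilon>0$, $$\lim_{T\to\infty}\mathbb{P}_{\nu\pi}\bigl(|\widehat\mu_2(T)-\mu(\theta_2)|\le\epsilon \,\big|\, N_2(T)\ge x\bigr)=1$$ uniformly for $x\in[T^\gamma,(1-\gamma)T]$. In particular, for all sufficiently large $T$ the event $\{N_2(T)\ge x\}$ has positive probability for all these $x$. -/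

import Mathlib

open MeasureTheory ProbabilityTheory

/-- A natural one-dimensional exponential family on `ℝ`: the data are a dominating measure `ρ`
and a carrier function `h ≥ 0`. The last field is the non-degeneracy of the distributions of the
family: the measure `h · ρ` is not concentrated on a single point. -/
structure ExpFamily where
  /-- the dominating measure -/
  ρ : Measure ℝ
  /-- the carrier function -/
  h : ℝ → ℝ
  measurable_h : Measurable h
  h_nonneg : ∀ x, 0 ≤ h x
  nondegenerate : ∀ c : ℝ, ρ {x | x ≠ c ∧ 0 < h x} ≠ 0

namespace ExpFamily

/-- The natural parameter space `Θ`: all `θ` with `∫ h(x) exp(x θ) ρ(dx) < ∞`. -/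
def paramSpace (M : ExpFamily) : Set ℝ :=
  {θ | Integrable (fun x => M.h x * Real.exp (x * θ)) M.ρ}

/-- The log-normalizer `A(θ) = log ∫ h(x) exp(x θ) ρ(dx)`. -/
noncomputable def logNormalizer (M : ExpFamily) (θ : ℝ) : ℝ :=
  Real.log (∫ x, M.h x * Real.exp (x * θ) ∂M.ρ)

/-- The density `p(x, θ) = h(x) exp(x θ - A(θ))`. -/
noncomputable def density (M : ExpFamily) (x θ : ℝ) : ℝ :=
  M.h x * Real.exp (x * θ - M.logNormalizer θ)

/-- The reward distribution with parameter `θ`: density `p(·, θ)` with respect to `ρ`. -/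
noncomputable def law (M : ExpFamily) (θ : ℝ) : Measure ℝ :=
  M.ρ.withDensity (fun x => ENNReal.ofReal (M.density x θ))

/-- The mean `μ(θ)` of the reward distribution with parameter `θ`. -/
noncomputable def mean (M : ExpFamily) (θ : ℝ) : ℝ := ∫ x, x ∂(M.law θ)

lemma integral_pos (M : ExpFamily) {θ : ℝ} (hθ : θ ∈ M.paramSpace) :
    0 < ∫ x, M.h x * Real.exp (x * θ) ∂M.ρ := by
  rw [integral_pos_iff_support_of_nonneg
    (fun x => mul_nonneg (M.h_nonneg x) (Real.exp_pos _).le) hθ]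
  refine lt_of_lt_of_le (pos_iff_ne_zero.mpr (M.nondegenerate 0)) (measure_mono ?_)
  rintro x ⟨-, hx⟩
  exact (mul_pos hx (Real.exp_pos _)).ne'

instance isProbabilityMeasure_law (M : ExpFamily) (θ : M.paramSpace) :
    IsProbabilityMeasure (M.law θ) := by
  constructor
  have hpos := M.integral_pos θ.2
  have hfun : (fun x => M.density x θ) = fun x =>
      (M.h x * Real.exp (x * (θ : ℝ))) * (∫ y, M.h y * Real.exp (y * (θ : ℝ)) ∂M.ρ)⁻¹ := by
    funext x
    rw [density, logNormalizer, Real.exp_sub, Real.exp_log hpos, div_eq_mul_inv, mul_assoc]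
  have hint : Integrable (fun x => M.density x θ) M.ρ := by
    rw [hfun]
    exact Integrable.mul_const θ.2 _
  rw [law, withDensity_apply _ MeasurableSet.univ, Measure.restrict_univ,
    ← ofReal_integral_eq_lintegral_ofReal hint
      (Filter.Eventually.of_forall fun x => mul_nonneg (M.h_nonneg x) (Real.exp_pos _).le),
    hfun, integral_mul_const, mul_inv_cancel₀ hpos.ne', ENNReal.ofReal_one]

/-- The two-armed environment `ν = (θ₁, θ₂)`; arm `1` has index `0` and arm `2` has index `1`. -/
noncomputable def env (M : ExpFamily) (θ₁ θ₂ : M.paramSpace) : Fin 2 → Measure ℝ :=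
  fun k => M.law (![θ₁, θ₂] k : M.paramSpace)

instance isProbabilityMeasure_env (M : ExpFamily) (θ₁ θ₂ : M.paramSpace) (k : Fin 2) :
    IsProbabilityMeasure (M.env θ₁ θ₂ k) := by
  unfold env
  infer_instance

end ExpFamily

/-- A (possibly randomized) two-armed bandit algorithm: the distribution of the first arm played,
and, for each `n`, the conditional distribution of the arm played in round `n + 1` given the arms
played and the rewards received in rounds `0, …, n`. -/
structure BanditAlgorithm where
  /-- the distribution of the first arm -/
  first : Measure (Fin 2)
  /-- the distribution of the next arm given the history -/
  policy : (n : ℕ) → Kernel (Finset.Iic n → Fin 2 × ℝ) (Fin 2)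
  [isProbabilityMeasure_first : IsProbabilityMeasure first]
  [isMarkovKernel_policy : ∀ n, IsMarkovKernel (policy n)]

attribute [instance] BanditAlgorithm.isProbabilityMeasure_first
attribute [instance] BanditAlgorithm.isMarkovKernel_policy

/-- The kernel that sends an arm to its reward distribution. -/
def rewardKernel (ν : Fin 2 → Measure ℝ) : Kernel (Fin 2) ℝ := Kernel.ofFunOfCountable ν

instance isMarkovKernel_rewardKernel (ν : Fin 2 → Measure ℝ) [∀ k, IsProbabilityMeasure (ν k)] :
    IsMarkovKernel (rewardKernel ν) :=
  ⟨fun k => inferInstanceAs (IsProbabilityMeasure (ν k))⟩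

namespace BanditAlgorithm

/-- One round of the interaction: given the history, the arm is drawn from the policy and then the
reward from the distribution of that arm. -/
noncomputable def stepKernel (π : BanditAlgorithm) (ν : Fin 2 → Measure ℝ) (n : ℕ) :
    Kernel (Finset.Iic n → Fin 2 × ℝ) (Fin 2 × ℝ) :=
  (π.policy n).compProd (Kernel.prodMkLeft (Finset.Iic n → Fin 2 × ℝ) (rewardKernel ν))

instance isMarkovKernel_stepKernel (π : BanditAlgorithm) (ν : Fin 2 → Measure ℝ)
    [∀ k, IsProbabilityMeasure (ν k)] (n : ℕ) : IsMarkovKernel (π.stepKernel ν n) := by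
  unfold stepKernel
  infer_instance

/-- The probability measure on sequences (arm, reward) induced by the algorithm `π` interacting
with the environment `ν`. -/
noncomputable def trajLaw (π : BanditAlgorithm) (ν : Fin 2 → Measure ℝ)
    [∀ k, IsProbabilityMeasure (ν k)] : Measure (ℕ → Fin 2 × ℝ) :=
  Kernel.trajMeasure (X := fun _ => Fin 2 × ℝ)
    (π.first.compProd (rewardKernel ν)) (π.stepKernel ν)

instance isProbabilityMeasure_trajLaw (π : BanditAlgorithm) (ν : Fin 2 → Measure ℝ)
    [∀ k, IsProbabilityMeasure (ν k)] : IsProbabilityMeasure (π.trajLaw ν) := by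
  unfold trajLaw
  infer_instance

end BanditAlgorithm

/-- `N_k(T)`: the number of plays of arm `k` in the first `T` rounds. -/
def numPlays (k : Fin 2) (T : ℕ) (ω : ℕ → Fin 2 × ℝ) : ℕ :=
  ((Finset.range T).filter (fun t => (ω t).1 = k)).card

/-- The sample mean of the rewards received from arm `k` in the first `T` rounds. -/
noncomputable def sampleMean (k : Fin 2) (T : ℕ) (ω : ℕ → Fin 2 × ℝ) : ℝ :=
  (∑ t ∈ (Finset.range T).filter (fun t => (ω t).1 = k), (ω t).2) / (numPlays k T ω : ℝ)

/-- Exchange the labels of the two arms along a trajectory. -/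
def swapArms (ω : ℕ → Fin 2 × ℝ) : ℕ → Fin 2 × ℝ :=
  fun t => (Equiv.swap 0 1 (ω t).1, (ω t).2)

/-- Invariance under permutation of the arm labels: in the environments `(θ₁, θ₂)` and `(θ₂, θ₁)`
the algorithm behaves in the same way (in law), with the arm labels swapped. -/
def LabelInvariant (M : ExpFamily) (π : BanditAlgorithm) : Prop :=
  ∀ θ₁ θ₂ : M.paramSpace,
    π.trajLaw (M.env θ₂ θ₁) = (π.trajLaw (M.env θ₁ θ₂)).map swapArms

/-- `π` is optimized over the exponential family `M`: if `θ₁ > θ₂`, then in the environment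
`(θ₁, θ₂)` one has `E[N₂(T)] / log T → 1 / D(θ₂, θ₁)`, with the Kullback-Leibler divergence `D`. -/
def IsOptimized (M : ExpFamily) (π : BanditAlgorithm) : Prop :=
  ∀ θ₁ θ₂ : M.paramSpace, (θ₂ : ℝ) < θ₁ →
    Filter.Tendsto
      (fun T : ℕ => (∫ ω, (numPlays 1 T ω : ℝ) ∂(π.trajLaw (M.env θ₁ θ₂))) / Real.log T)
      Filter.atTop
      (nhds ((InformationTheory.klDiv (M.law θ₂) (M.law θ₁))⁻¹).toReal)

/-!
The event `N₂(T) ≥ x` has at least polynomially small probability for `x ≤ (1 - γ) T`, whereas a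
deviation of the sample mean of arm `2` after at least `T ^ γ` plays has probability at most
`2 exp (-c T ^ γ)`. Hence deviations are negligible even after conditioning on `N₂(T) ≥ x`. Both
bounds are changes of measure along the trajectory
(`BanditAlgorithm.trajLaw_apply_eq_setLIntegral_armSum`).

For the upper bound (`ExpFamily.exists_trajLaw_le_exp`), `θ₂` lies in the interior of `Θ`, because
it is neither the smallest nor the largest element. Tilting arm `2` to a nearby parameter is the
Chernoff method: on the event that arm `2` has at least `x` plays and a sample mean which is off
by `ε`, the likelihood ratio is at least `exp (c x)`.

For the lower bound (`ExpFamily.exists_exp_log_le_trajLaw`), `θ₁` is replaced by an interior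
parameter `θ < θ₂`. In the new environment arm `1` is inferior, so by the invariance under relabeling
and the optimality of the algorithm it has `O(log T)` plays in expectation. By Wald's identity
and Markov's inequality, with probability at least `1 / 2` both the number of plays of arm `1` and
the log-likelihood ratio with respect to the original environment are `O(log T)`. In the original
environment this event therefore has probability at least `T ^ (-C) / 2`, and on it arm `2` takes
all but `O(log T)` of the rounds.
-/

/-! ### The law of the trajectory under a change of environment -/

open Preorder in
lemma BanditAlgorithm.map_eval_zero_trajLaw (π : BanditAlgorithm) (ν : Fin 2 → Measure ℝ)
    [∀ k, IsProbabilityMeasure (ν k)] :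
    (π.trajLaw ν).map (fun ω => ω 0) = π.first.compProd (rewardKernel ν) := by
  have h : (fun ω : ℕ → Fin 2 × ℝ => ω 0) =
      (fun y : (i : Finset.Iic 0) → Fin 2 × ℝ => y ⟨0, by simp⟩) ∘ frestrictLe 0 := rfl
  rw [trajLaw, Kernel.trajMeasure, h, ← Measure.map_map (by fun_prop) (by fun_prop),
    Measure.map_comp _ _ (by fun_prop), Kernel.traj_map_frestrictLe, Kernel.partialTraj_self,
    Measure.id_comp, Measure.map_map (by fun_prop) (by fun_prop)]
  exact Measure.map_id

lemma BanditAlgorithm.lintegral_trajLaw_zero (π : BanditAlgorithm) (ν : Fin 2 → Measure ℝ)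
    [∀ k, IsProbabilityMeasure (ν k)] {f : Fin 2 × ℝ → ENNReal} (hf : Measurable f) :
    ∫⁻ ω, f (ω 0) ∂(π.trajLaw ν) = ∫⁻ a, ∫⁻ x, f (a, x) ∂(ν a) ∂π.first := by
  rw [← lintegral_map (μ := π.trajLaw ν) (g := fun ω => ω 0) hf (by fun_prop),
    π.map_eval_zero_trajLaw ν]
  exact Measure.lintegral_compProd hf

open Preorder in
lemma BanditAlgorithm.lintegral_trajLaw_succ (π : BanditAlgorithm) (ν : Fin 2 → Measure ℝ)
    [∀ k, IsProbabilityMeasure (ν k)] (n : ℕ)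
    {f : (Finset.Iic n → Fin 2 × ℝ) × (Fin 2 × ℝ) → ENNReal} (hf : Measurable f) :
    ∫⁻ ω, f (frestrictLe n ω, ω (n + 1)) ∂(π.trajLaw ν) =
      ∫⁻ ω, ∫⁻ a, ∫⁻ x, f (frestrictLe n ω, (a, x)) ∂(ν a) ∂(π.policy n (frestrictLe n ω))
        ∂(π.trajLaw ν) := by
  have h := Kernel.map_frestrictLe_trajMeasure_compProd_eq_map_trajMeasure
    (X := fun _ => Fin 2 × ℝ) (μ₀ := π.first.compProd (rewardKernel ν))
    (κ := π.stepKernel ν) (a := n)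
  change (π.trajLaw ν).map (frestrictLe n) ⊗ₘ _ = (π.trajLaw ν).map _ at h
  rw [← lintegral_map (μ := π.trajLaw ν) (g := fun ω => (frestrictLe n ω, ω (n + 1))) hf
    (by fun_prop), ← h, Measure.lintegral_compProd hf, lintegral_map hf.lintegral_kernel_prod_right'
    (by fun_prop)]
  refine lintegral_congr fun ω => ?_
  exact Kernel.lintegral_compProd _ _ _ (hf.comp measurable_prodMk_left)

open Preorder in
/-- Change of measure between two environments: on the first `n + 1` rounds, the law of the
trajectory under `ν'` has a density with respect to the law under `ν` which is the product of the
densities of the rewards, since the probabilities of the arm choices cancel. -/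
lemma BanditAlgorithm.lintegral_trajLaw_withDensity (π : BanditAlgorithm)
    (ν ν' : Fin 2 → Measure ℝ)
    [∀ k, IsProbabilityMeasure (ν k)] [∀ k, IsProbabilityMeasure (ν' k)]
    {w : Fin 2 × ℝ → ENNReal} (hw : Measurable w)
    (hν : ∀ k, ν' k = (ν k).withDensity (fun x => w (k, x))) (n : ℕ)
    {f : (Finset.Iic n → Fin 2 × ℝ) → ENNReal} (hf : Measurable f) :
    ∫⁻ ω, f (frestrictLe n ω) ∂(π.trajLaw ν') =
      ∫⁻ ω, (∏ t ∈ Finset.range (n + 1), w (ω t)) * f (frestrictLe n ω) ∂(π.trajLaw ν) := by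
  -- Change of measure for a single reward.
  have key : ∀ (g : Fin 2 × ℝ → ENNReal), Measurable g → ∀ a,
      ∫⁻ x, g (a, x) ∂(ν' a) = ∫⁻ x, w (a, x) * g (a, x) ∂(ν a) := by
    intro g hg a
    rw [hν a, lintegral_withDensity_eq_lintegral_mul _ (by fun_prop) (by fun_prop)]
    rfl
  induction n with
  | zero =>
    let e : Fin 2 × ℝ → (Finset.Iic 0 → Fin 2 × ℝ) := fun p _ => p
    have he : Measurable e := by fun_prop
    have h0 : ∀ ω : ℕ → Fin 2 × ℝ, frestrictLe 0 ω = e (ω 0) := by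
      intro ω
      ext1 ⟨i, hi⟩
      obtain rfl : i = 0 := by simpa using hi
      rfl
    simp only [h0, zero_add, Finset.range_one, Finset.prod_singleton]
    rw [π.lintegral_trajLaw_zero ν' (f := fun p => f (e p)) (by fun_prop),
      π.lintegral_trajLaw_zero ν (f := fun p => w p * f (e p)) (by fun_prop)]
    exact lintegral_congr fun a => key (fun p => f (e p)) (by fun_prop) a
  | succ n ih =>
    -- `e` appends the round `n + 1` to the history of the rounds up to `n`.
    let e : (Finset.Iic n → Fin 2 × ℝ) × (Fin 2 × ℝ) → (Finset.Iic (n + 1) → Fin 2 × ℝ) :=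
      fun p i => if h : (i : ℕ) ≤ n then p.1 ⟨i, by simpa using h⟩ else p.2
    have he : Measurable e := by
      refine measurable_pi_lambda _ fun i => ?_
      by_cases h : (i : ℕ) ≤ n
      · simp only [e, h, dite_true]; fun_prop
      · simp only [e, h, dite_false]; fun_prop
    have h1 : ∀ ω : ℕ → Fin 2 × ℝ, frestrictLe (n + 1) ω = e (frestrictLe n ω, ω (n + 1)) := by
      intro ω
      ext1 ⟨i, hi⟩
      have hi' : i ≤ n + 1 := by simpa using hi
      by_cases h : i ≤ n
      · simp [e, h]
      · obtain rfl : i = n + 1 := by omega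
        simp [e]
    -- The weight of the first `n + 1` rounds, as a function of the history.
    let W : (Finset.Iic n → Fin 2 × ℝ) → ENNReal := fun y => ∏ t : Finset.Iic n, w (y t)
    have hW : Measurable W := by fun_prop
    have hWω : ∀ ω : ℕ → Fin 2 × ℝ,
        ∏ t ∈ Finset.range (n + 1), w (ω t) = W (frestrictLe n ω) := by
      intro ω
      have : Finset.range (n + 1) = Finset.Iic n := by ext; simp
      rw [this, ← Finset.prod_coe_sort]
      rfl
    simp only [Finset.prod_range_succ _ (n + 1), h1]
    rw [π.lintegral_trajLaw_succ ν' n (f := fun p => f (e p)) (by fun_prop)]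
    simp only [hWω] at ih ⊢
    rw [π.lintegral_trajLaw_succ ν n (f := fun p => W p.1 * w p.2 * f (e p)) (by fun_prop)]
    -- The induction hypothesis is applied to the weighted integral over round `n + 1`.
    let g : (Finset.Iic n → Fin 2 × ℝ) → ENNReal :=
      fun y => ∫⁻ a, ∫⁻ x, w (a, x) * f (e (y, (a, x))) ∂(ν a) ∂(π.policy n y)
    have hg : Measurable g := by
      have : g = fun y => ∫⁻ p, w p * f (e (y, p)) ∂(π.stepKernel ν n y) := by
        funext y
        exact (Kernel.lintegral_compProd (π.policy n) (Kernel.prodMkLeft _ (rewardKernel ν)) y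
          (f := fun p => w p * f (e (y, p))) (by fun_prop)).symm
      rw [this]
      exact Measurable.lintegral_kernel_prod_right (κ := π.stepKernel ν n)
        (f := fun y p => w p * f (e (y, p))) (by fun_prop)
    have h2 := ih hg
    convert h2 using 1
    · refine lintegral_congr fun ω => lintegral_congr fun a => ?_
      exact key (fun p => f (e (frestrictLe n ω, p))) (by fun_prop) a
    · refine lintegral_congr fun ω => ?_
      simp only [g]
      rw [← lintegral_const_mul _ (measurable_of_countable _)]
      refine lintegral_congr fun a => ?_
      rw [← lintegral_const_mul _ (by fun_prop)]
      simp only [mul_assoc]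

/-- Conditionally on the arm of round `t`, the reward of that round has the distribution of the
arm. -/
lemma BanditAlgorithm.lintegral_trajLaw_eval (π : BanditAlgorithm) (ν : Fin 2 → Measure ℝ)
    [∀ k, IsProbabilityMeasure (ν k)] {g : Fin 2 × ℝ → ENNReal} (hg : Measurable g) (t : ℕ) :
    ∫⁻ ω, g (ω t) ∂(π.trajLaw ν) =
      ∫⁻ ω, ∫⁻ x, g ((ω t).1, x) ∂(ν (ω t).1) ∂(π.trajLaw ν) := by
  have hm : Measurable (fun p : Fin 2 × ℝ => ∫⁻ x, g (p.1, x) ∂(ν p.1)) :=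
    (measurable_of_countable (fun a => ∫⁻ x, g (a, x) ∂(ν a))).comp measurable_fst
  cases t with
  | zero =>
    rw [π.lintegral_trajLaw_zero ν hg, π.lintegral_trajLaw_zero ν hm]
    simp
  | succ n =>
    rw [π.lintegral_trajLaw_succ ν n (f := fun p => g p.2) (by fun_prop),
      π.lintegral_trajLaw_succ ν n (f := fun p => ∫⁻ x, g (p.2.1, x) ∂(ν p.2.1))
        (hm.comp measurable_snd)]
    simp

open Preorder in
/-- The change of measure for an event `s` that is determined by the first `T` rounds. -/
lemma BanditAlgorithm.trajLaw_apply_eq_setLIntegral (π : BanditAlgorithm)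
    (ν ν' : Fin 2 → Measure ℝ)
    [∀ k, IsProbabilityMeasure (ν k)] [∀ k, IsProbabilityMeasure (ν' k)]
    {w : Fin 2 × ℝ → ENNReal} (hw : Measurable w)
    (hν : ∀ k, ν' k = (ν k).withDensity (fun x => w (k, x))) {T : ℕ} (hT : 0 < T)
    {s : Set (ℕ → Fin 2 × ℝ)} (hs : MeasurableSet s)
    (hsT : DependsOn (· ∈ s) (Set.Iio T)) :
    π.trajLaw ν' s = ∫⁻ ω in s, ∏ t ∈ Finset.range T, w (ω t) ∂(π.trajLaw ν) := by
  obtain ⟨n, rfl⟩ : ∃ n, T = n + 1 := ⟨T - 1, by omega⟩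
  -- `e` continues a history by an arbitrary constant.
  let e : (Finset.Iic n → Fin 2 × ℝ) → (ℕ → Fin 2 × ℝ) :=
    fun y i => if h : i ≤ n then y ⟨i, by simpa using h⟩ else (0, 0)
  have he : Measurable e := by
    refine measurable_pi_lambda _ fun i => ?_
    by_cases h : i ≤ n
    · simp only [e, h, dite_true]; fun_prop
    · simp only [e, h, dite_false]; fun_prop
  have hse : ∀ ω, s.indicator (1 : (ℕ → Fin 2 × ℝ) → ENNReal) ω =
      (e ⁻¹' s).indicator 1 (frestrictLe n ω) := by
    intro ω
    have : ω ∈ s ↔ e (frestrictLe n ω) ∈ s := by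
      refine iff_of_eq <| hsT fun i hi => ?_
      have hi' : i ≤ n := Nat.lt_succ_iff.mp hi
      simp [e, hi']
    by_cases h : ω ∈ s
    · rw [Set.indicator_of_mem h, Set.indicator_of_mem (Set.mem_preimage.mpr (this.mp h))]
      rfl
    · rw [Set.indicator_of_notMem h,
        Set.indicator_of_notMem (fun h' => h (this.mpr (Set.mem_preimage.mp h')))]
  rw [← lintegral_indicator_one hs, ← lintegral_indicator hs]
  rw [lintegral_congr hse, π.lintegral_trajLaw_withDensity ν ν' hw hν n
    (f := (e ⁻¹' s).indicator 1) (measurable_one.indicator (he hs))]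
  refine lintegral_congr fun ω => ?_
  rw [← hse]
  by_cases h : ω ∈ s <;> simp [h]

/-! ### The exponential family as a family of tilted measures -/

namespace ExpFamily

/-- The carrier measure `h · ρ`. The members of the family are its exponential tilts. -/
noncomputable def baseMeasure (M : ExpFamily) : Measure ℝ :=
  M.ρ.withDensity (fun x => ENNReal.ofReal (M.h x))

lemma measurable_density (M : ExpFamily) (θ : ℝ) : Measurable (fun x => M.density x θ) := by
  have := M.measurable_h
  unfold density
  fun_prop

lemma paramSpace_eq_integrableExpSet (M : ExpFamily) :
    M.paramSpace = integrableExpSet id M.baseMeasure := by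
  ext θ
  have := M.measurable_h
  rw [integrableExpSet, Set.mem_ofPred_eq, baseMeasure,
    integrable_withDensity_iff_integrable_smul₀' (by fun_prop) (by simp)]
  simp only [ENNReal.toReal_ofReal (M.h_nonneg _), smul_eq_mul, id, mul_comm θ]
  rfl

lemma integral_baseMeasure (M : ExpFamily) (f : ℝ → ℝ) :
    ∫ x, f x ∂M.baseMeasure = ∫ x, M.h x * f x ∂M.ρ := by
  have := M.measurable_h
  rw [baseMeasure, integral_withDensity_eq_integral_toReal_smul (by fun_prop) (by simp)]
  simp only [ENNReal.toReal_ofReal (M.h_nonneg _), smul_eq_mul]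

lemma logNormalizer_eq_cgf (M : ExpFamily) : M.logNormalizer = cgf id M.baseMeasure := by
  funext θ
  simp only [logNormalizer, cgf, mgf, integral_baseMeasure, id, mul_comm θ]

lemma law_eq_tilted (M : ExpFamily) {θ : ℝ} (hθ : θ ∈ M.paramSpace) :
    M.law θ = M.baseMeasure.tilted (fun x => θ * id x) := by
  have := M.measurable_h
  rw [Measure.tilted, integral_baseMeasure, baseMeasure, ← withDensity_mul _ (by fun_prop)
    (by fun_prop), law]
  congr 1
  funext x
  simp only [density, logNormalizer, Pi.mul_apply, id, mul_comm θ]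
  rw [← ENNReal.ofReal_mul (M.h_nonneg x), Real.exp_sub, Real.exp_log (M.integral_pos hθ)]

/-- The density of one member of the family with respect to another. It holds for all real `θ`, `θ'`,
whatever the values of the log-normalizer outside of the parameter space. -/
lemma law_eq_withDensity_law (M : ExpFamily) (θ θ' : ℝ) :
    M.law θ' = (M.law θ).withDensity (fun x => ENNReal.ofReal
      (Real.exp ((θ' - θ) * x - (M.logNormalizer θ' - M.logNormalizer θ)))) := by
  have := M.measurable_density θ
  rw [law, law, ← withDensity_mul _ (by fun_prop) (by fun_prop)]
  congr 1
  funext x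
  rw [Pi.mul_apply, density, density,
    ← ENNReal.ofReal_mul (mul_nonneg (M.h_nonneg x) (Real.exp_pos _).le), mul_assoc,
    ← Real.exp_add]
  ring_nf

lemma mem_interior_paramSpace (M : ExpFamily) {a b θ : ℝ} (ha : a ∈ M.paramSpace)
    (hb : b ∈ M.paramSpace) (haθ : a < θ) (hθb : θ < b) : θ ∈ interior M.paramSpace := by
  have hc : Convex ℝ M.paramSpace := by
    rw [paramSpace_eq_integrableExpSet]; exact convex_integrableExpSet
  exact interior_maximal (Set.Ioo_subset_Icc_self.trans (hc.ordConnected.out ha hb)) isOpen_Ioo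
    ⟨haθ, hθb⟩

lemma hasDerivAt_logNormalizer (M : ExpFamily) {θ : ℝ} (hθ : θ ∈ interior M.paramSpace) :
    HasDerivAt M.logNormalizer (M.mean θ) θ := by
  have hmem := interior_subset hθ
  rw [paramSpace_eq_integrableExpSet] at hθ
  have h := integral_tilted_mul_self hθ
  rw [← M.law_eq_tilted hmem, ← logNormalizer_eq_cgf] at h
  rw [mean]
  simp only [id] at h
  rw [h, logNormalizer_eq_cgf]
  exact (analyticAt_cgf hθ).differentiableAt.hasDerivAt

lemma integrable_id_law (M : ExpFamily) {θ : ℝ} (hθ : θ ∈ interior M.paramSpace) :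
    Integrable (fun x => x) (M.law θ) := by
  have hmem := interior_subset hθ
  rw [paramSpace_eq_integrableExpSet] at hθ
  have h := memLp_tilted_mul hθ 1
  rw [← M.law_eq_tilted hmem] at h
  rw [ENNReal.coe_one] at h
  exact memLp_one_iff_integrable.mp h

/-- A small tilt in the direction `s` gives a positive Chernoff exponent for a deviation `ε` of the
mean, because the derivative of the log-normalizer at `θ` is the mean. -/
lemma exists_tilt (M : ExpFamily) {θ : ℝ} (hθ : θ ∈ interior M.paramSpace)
    {ε : ℝ} (hε : 0 < ε) (s : ℝ) :
    ∃ u : ℝ, 0 < u ∧ θ + s * u ∈ M.paramSpace ∧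
      M.logNormalizer (θ + s * u) - M.logNormalizer θ < u * (s * M.mean θ + ε) := by
  have hd : HasDerivAt (fun u => M.logNormalizer (θ + s * u)) (M.mean θ * s) 0 := by
    have h1 : HasDerivAt (fun u => θ + s * u) s 0 := by
      simpa using ((hasDerivAt_id (0 : ℝ)).const_mul s).const_add θ
    have h2 : HasDerivAt M.logNormalizer (M.mean θ) (θ + s * 0) := by
      simpa using M.hasDerivAt_logNormalizer hθ
    exact HasDerivAt.comp (h₂ := M.logNormalizer) 0 h2 h1
  have hlo := (hd.tendsto_slope_zero_right).eventually_lt_const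
    (show M.mean θ * s < s * M.mean θ + ε by linarith)
  have hmem : ∀ᶠ u in nhdsWithin (0 : ℝ) (Set.Ioi 0), θ + s * u ∈ M.paramSpace := by
    have hc : Filter.Tendsto (fun u : ℝ => θ + s * u) (nhds 0) (nhds θ) := by
      have : Continuous (fun u : ℝ => θ + s * u) := by fun_prop
      simpa using this.tendsto 0
    exact ((hc.mono_left nhdsWithin_le_nhds).eventually
      (mem_interior_iff_mem_nhds.mp hθ))
  obtain ⟨u, h1, h2, h3⟩ := (hlo.and (hmem.and self_mem_nhdsWithin)).exists
  have hu : 0 < u := h3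
  refine ⟨u, hu, h2, ?_⟩
  simp only [zero_add, mul_zero, add_zero, smul_eq_mul] at h1
  rwa [inv_mul_lt_iff₀ hu] at h1

end ExpFamily

/-! ### Sums over the rewards of one arm -/

/-- The sum of `g` over the rewards received from arm `k` in the first `T` rounds; for the constant
`1` it is the number of plays, as a real number. -/
noncomputable def armSum (k : Fin 2) (g : ℝ → ℝ) (T : ℕ) (ω : ℕ → Fin 2 × ℝ) : ℝ :=
  ∑ t ∈ (Finset.range T).filter (fun t => (ω t).1 = k), g (ω t).2

lemma armSum_eq_sum_ite (k : Fin 2) (g : ℝ → ℝ) (T : ℕ) (ω : ℕ → Fin 2 × ℝ) :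
    armSum k g T ω = ∑ t ∈ Finset.range T, if (ω t).1 = k then g (ω t).2 else 0 := by
  rw [armSum, Finset.sum_filter]

lemma natCast_numPlays_eq_armSum (k : Fin 2) (T : ℕ) (ω : ℕ → Fin 2 × ℝ) :
    (numPlays k T ω : ℝ) = armSum k (fun _ => 1) T ω := by
  simp [numPlays, armSum]

lemma sampleMean_eq_armSum_div (k : Fin 2) (T : ℕ) (ω : ℕ → Fin 2 × ℝ) :
    sampleMean k T ω = armSum k (fun x => x) T ω / armSum k (fun _ => 1) T ω := by
  rw [← natCast_numPlays_eq_armSum]; rfl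

lemma armSum_const (k : Fin 2) (a : ℝ) (T : ℕ) (ω : ℕ → Fin 2 × ℝ) :
    armSum k (fun _ => a) T ω = a * armSum k (fun _ => 1) T ω := by
  simp [armSum, mul_comm]

lemma armSum_affine (k : Fin 2) (a b : ℝ) (T : ℕ) (ω : ℕ → Fin 2 × ℝ) :
    armSum k (fun x => a * x - b) T ω =
      a * armSum k (fun x => x) T ω - b * armSum k (fun _ => 1) T ω := by
  rw [← armSum_const]
  simp only [armSum, Finset.sum_sub_distrib, Finset.mul_sum]

lemma armSum_mono (k : Fin 2) {f g : ℝ → ℝ} (h : ∀ x, f x ≤ g x) (T : ℕ)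
    (ω : ℕ → Fin 2 × ℝ) : armSum k f T ω ≤ armSum k g T ω :=
  Finset.sum_le_sum fun _ _ => h _

lemma measurable_ite_arm (k : Fin 2) {g : ℝ → ℝ} (hg : Measurable g) :
    Measurable (fun p : Fin 2 × ℝ => if p.1 = k then g p.2 else 0) :=
  Measurable.ite (measurable_fst (measurableSet_singleton k)) (by fun_prop) measurable_const

lemma measurable_armSum (k : Fin 2) {g : ℝ → ℝ} (hg : Measurable g) (T : ℕ) :
    Measurable (armSum k g T) := by
  simp_rw [funext (armSum_eq_sum_ite k g T)]
  refine Finset.measurable_sum _ fun t _ => ?_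
  exact (measurable_ite_arm k hg).comp (measurable_pi_apply t)

lemma dependsOn_armSum (k : Fin 2) (g : ℝ → ℝ) (T : ℕ) :
    DependsOn (armSum k g T) (Set.Iio T) := by
  intro ω ω' h
  rw [armSum_eq_sum_ite, armSum_eq_sum_ite]
  refine Finset.sum_congr rfl fun t ht => ?_
  rw [h t (Finset.mem_range.mp ht)]

lemma armSum_zero_add_armSum_one (T : ℕ) (ω : ℕ → Fin 2 × ℝ) :
    armSum 0 (fun _ => 1) T ω + armSum 1 (fun _ => 1) T ω = T := by
  rw [armSum_eq_sum_ite, armSum_eq_sum_ite, ← Finset.sum_add_distrib]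
  have : ∀ t, ((if (ω t).1 = 0 then (1 : ℝ) else 0) + if (ω t).1 = 1 then (1 : ℝ) else 0) = 1 := by
    intro t
    generalize (ω t).1 = a
    fin_cases a <;> simp
  simp [this]

lemma armSum_nonneg (k : Fin 2) {g : ℝ → ℝ} (hg : ∀ x, 0 ≤ g x) (T : ℕ) (ω : ℕ → Fin 2 × ℝ) :
    0 ≤ armSum k g T ω := Finset.sum_nonneg fun _ _ => hg _

lemma measurable_swapArms : Measurable swapArms := by
  refine measurable_pi_lambda _ fun t => ?_
  have h : Measurable (fun a : Fin 2 => Equiv.swap (0 : Fin 2) 1 a) := measurable_of_countable _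
  unfold swapArms
  fun_prop

lemma armSum_swapArms (g : ℝ → ℝ) (T : ℕ) (ω : ℕ → Fin 2 × ℝ) :
    armSum 1 g T (swapArms ω) = armSum 0 g T ω := by
  rw [armSum_eq_sum_ite, armSum_eq_sum_ite]
  have h : ∀ a : Fin 2, Equiv.swap (0 : Fin 2) 1 a = 1 ↔ a = 0 := by decide
  simp only [swapArms, h]

/-! ### Wald's identity and changes of measure on one arm -/

namespace BanditAlgorithm

/-- Wald's identity at the fixed time `T`: the number of plays of arm `k` may depend on the rewards,
but each decision to play it is made before the reward of that round is drawn. -/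
lemma lintegral_armSum (π : BanditAlgorithm) (ν : Fin 2 → Measure ℝ)
    [∀ k, IsProbabilityMeasure (ν k)] (k : Fin 2) {g : ℝ → ℝ} (hg : Measurable g)
    (hg0 : ∀ x, 0 ≤ g x) (T : ℕ) :
    ∫⁻ ω, ENNReal.ofReal (armSum k g T ω) ∂(π.trajLaw ν) =
      (∫⁻ x, ENNReal.ofReal (g x) ∂(ν k)) *
        ∫⁻ ω, ENNReal.ofReal (armSum k (fun _ => 1) T ω) ∂(π.trajLaw ν) := by
  have hexp : ∀ f : ℝ → ℝ, Measurable f → (∀ x, 0 ≤ f x) →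
      ∫⁻ ω, ENNReal.ofReal (armSum k f T ω) ∂(π.trajLaw ν) = ∑ t ∈ Finset.range T,
        ∫⁻ ω, ENNReal.ofReal (if (ω t).1 = k then f (ω t).2 else 0) ∂(π.trajLaw ν) := by
    intro f hf hf0
    rw [← lintegral_finsetSum]
    · refine lintegral_congr fun ω => ?_
      rw [armSum_eq_sum_ite, ENNReal.ofReal_sum_of_nonneg]
      intro t _
      split_ifs
      exacts [hf0 _, le_rfl]
    · intro t _
      exact (((measurable_ite_arm k hf).comp (measurable_pi_apply t))).ennreal_ofReal
  rw [hexp g hg hg0, hexp _ measurable_const fun _ => zero_le_one, Finset.mul_sum]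
  refine Finset.sum_congr rfl fun t _ => ?_
  have hmeas : Measurable fun ω : ℕ → Fin 2 × ℝ =>
      ENNReal.ofReal (if (ω t).1 = k then (1 : ℝ) else 0) :=
    ((measurable_ite_arm k (g := fun _ => 1) measurable_const).comp
      (measurable_pi_apply t)).ennreal_ofReal
  rw [π.lintegral_trajLaw_eval ν
      (g := fun p => ENNReal.ofReal (if p.1 = k then g p.2 else 0))
      (measurable_ite_arm k hg).ennreal_ofReal t,
    ← lintegral_const_mul _ hmeas]
  refine lintegral_congr fun ω => ?_
  by_cases h : (ω t).1 = k
  · simp [h]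
  · simp [h]

/-- Change of measure when only the distribution of arm `k` is changed, by the density `exp g`:
the log-likelihood ratio after `T` rounds is the sum of `g` over the rewards from arm `k`. -/
lemma trajLaw_apply_eq_setLIntegral_armSum (π : BanditAlgorithm) (ν ν' : Fin 2 → Measure ℝ)
    [∀ k, IsProbabilityMeasure (ν k)] [∀ k, IsProbabilityMeasure (ν' k)] (k : Fin 2)
    {g : ℝ → ℝ} (hg : Measurable g)
    (hk : ν' k = (ν k).withDensity (fun x => ENNReal.ofReal (Real.exp (g x))))
    (hne : ∀ j, j ≠ k → ν' j = ν j) {T : ℕ} (hT : 0 < T)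
    {s : Set (ℕ → Fin 2 × ℝ)} (hs : MeasurableSet s) (hsT : DependsOn (· ∈ s) (Set.Iio T)) :
    π.trajLaw ν' s =
      ∫⁻ ω in s, ENNReal.ofReal (Real.exp (armSum k g T ω)) ∂(π.trajLaw ν) := by
  rw [π.trajLaw_apply_eq_setLIntegral ν ν'
    (w := fun p => ENNReal.ofReal (Real.exp (if p.1 = k then g p.2 else 0)))
    (measurable_ite_arm k hg).exp.ennreal_ofReal ?_ hT hs hsT]
  · refine lintegral_congr fun ω => ?_
    rw [armSum_eq_sum_ite, Real.exp_sum, ENNReal.ofReal_prod_of_nonneg]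
    exact fun _ _ => (Real.exp_pos _).le
  · intro j
    by_cases h : j = k
    · subst h; simpa using hk
    · simp [h, hne j h]

end BanditAlgorithm

/-! ### Tail bounds for an exponential family -/

namespace ExpFamily

variable (M : ExpFamily) (π : BanditAlgorithm)

/-- Chernoff bound for the rewards of arm `2`, uniform in the adaptive number of plays: the
likelihood ratio of the environment with `θ₂` replaced by `θ₂ + s u` is at least `exp (c x)` on the
event, and its integral over the event is a probability. The signs `s = 1` and `s = -1` give
the upper and the lower deviations of the sample mean. -/
lemma exists_trajLaw_le_exp {θ₁ θ₂ : M.paramSpace} (h₂ : (θ₂ : ℝ) ∈ interior M.paramSpace)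
    {ε : ℝ} (hε : 0 < ε) (s : ℝ) :
    ∃ c : ℝ, 0 < c ∧ ∀ T : ℕ, 0 < T → ∀ x : ℝ,
      (π.trajLaw (M.env θ₁ θ₂)).real {ω | x ≤ armSum 1 (fun _ => 1) T ω ∧
        ε * armSum 1 (fun _ => 1) T ω ≤
          s * (armSum 1 (fun x => x) T ω - M.mean θ₂ * armSum 1 (fun _ => 1) T ω)} ≤
        Real.exp (-(c * x)) := by
  obtain ⟨u, hu, hmem, hlt⟩ := M.exists_tilt h₂ hε s
  set Δ := M.logNormalizer (θ₂ + s * u) - M.logNormalizer θ₂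
  let c := u * (s * M.mean θ₂ + ε) - Δ
  have hc : 0 < c := sub_pos.mpr hlt
  refine ⟨c, hc, fun T hT x => ?_⟩
  set E : Set (ℕ → Fin 2 × ℝ) := {ω | x ≤ armSum 1 (fun _ => 1) T ω ∧
        ε * armSum 1 (fun _ => 1) T ω ≤
          s * (armSum 1 (fun x => x) T ω - M.mean θ₂ * armSum 1 (fun _ => 1) T ω)} with hE
  have m1 := measurable_armSum 1 (g := fun _ => 1) measurable_const T
  have m2 := measurable_armSum 1 (g := fun x => x) measurable_id T
  have hEm : MeasurableSet E :=
    (measurableSet_le measurable_const m1).inter 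
      (measurableSet_le (m1.const_mul ε) ((m2.sub (m1.const_mul _)).const_mul s))
  have hET : DependsOn (· ∈ E) (Set.Iio T) := by
    intro ω ω' h
    simp only [hE, Set.mem_ofPred_eq, dependsOn_armSum 1 (fun _ => 1) T h,
      dependsOn_armSum 1 (fun x => x) T h]
  let θ' : M.paramSpace := ⟨θ₂ + s * u, hmem⟩
  have hcm := π.trajLaw_apply_eq_setLIntegral_armSum (M.env θ₁ θ₂) (M.env θ₁ θ') 1
    (g := fun x => (s * u) * x - Δ) (by fun_prop)
    (by
      have := M.law_eq_withDensity_law θ₂ (θ₂ + s * u)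
      simp only [add_sub_cancel_left] at this
      simpa [env, θ', Δ] using this)
    (by intro j hj; fin_cases j <;> simp_all [env]) hT hEm hET
  have hle : ENNReal.ofReal (Real.exp (c * x)) * (π.trajLaw (M.env θ₁ θ₂)) E ≤ 1 := by
    calc _ = ∫⁻ ω in E, ENNReal.ofReal (Real.exp (c * x)) ∂(π.trajLaw (M.env θ₁ θ₂)) := by simp
      _ ≤ _ := by
        refine setLIntegral_mono' hEm fun ω hω => ENNReal.ofReal_le_ofReal (Real.exp_le_exp.mpr ?_)
        rw [armSum_affine]
        have h1 := mul_le_mul_of_nonneg_left hω.1 hc.le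
        have h2 := mul_le_mul_of_nonneg_left hω.2 hu.le
        simp only [c] at h1 ⊢
        linarith
      _ = _ := hcm.symm
      _ ≤ 1 := prob_le_one
  have h3 := ENNReal.toReal_mono ENNReal.one_ne_top hle
  rw [ENNReal.toReal_mul, ENNReal.toReal_ofReal (Real.exp_pos _).le, ENNReal.toReal_one] at h3
  rw [Real.exp_neg, ← one_div, le_div_iff₀ (Real.exp_pos _), mul_comm]
  exact h3

/-- If arm `1` is the inferior arm, the expected number of its plays is at most logarithmic. This is
`IsOptimized` for the environment with the arms exchanged. -/
lemma exists_lintegral_armSum_le_log (hπ : LabelInvariant M π) (hA1 : IsOptimized M π)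
    {θ₁ θ₂ : M.paramSpace} (hθ : (θ₁ : ℝ) < θ₂) :
    ∃ K : ℝ, 0 < K ∧ ∀ᶠ T : ℕ in Filter.atTop,
      ∫⁻ ω, ENNReal.ofReal (armSum 0 (fun _ => 1) T ω) ∂(π.trajLaw (M.env θ₁ θ₂)) ≤
        ENNReal.ofReal (K * Real.log T) := by
  have h := hA1 θ₂ θ₁ hθ
  set l := ((InformationTheory.klDiv (M.law θ₁) (M.law θ₂))⁻¹).toReal
  have hl : 0 ≤ l := ENNReal.toReal_nonneg
  refine ⟨l + 1, by positivity, ?_⟩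
  filter_upwards [h.eventually_le_const (lt_add_one l), Filter.eventually_gt_atTop 1] with T h1 hT
  have hlog : 0 < Real.log T := Real.log_pos (by exact_mod_cast hT)
  rw [div_le_iff₀ hlog, hπ θ₁ θ₂] at h1
  simp only [natCast_numPlays_eq_armSum] at h1
  have m1 := measurable_armSum 1 (g := fun _ => 1) measurable_const T
  have m0 := measurable_armSum 0 (g := fun _ => 1) measurable_const T
  rw [integral_map measurable_swapArms.aemeasurable m1.aestronglyMeasurable] at h1
  simp only [armSum_swapArms] at h1
  have hnn : ∀ k ω, 0 ≤ armSum k (fun _ => 1) T ω := fun k ω =>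
    armSum_nonneg k (fun _ => zero_le_one) T ω
  rw [← ofReal_integral_eq_lintegral_ofReal]
  · exact ENNReal.ofReal_le_ofReal h1
  · refine Integrable.of_bound m0.aestronglyMeasurable (T : ℝ) (Filter.Eventually.of_forall ?_)
    intro ω
    rw [Real.norm_of_nonneg (hnn 0 ω)]
    linarith [armSum_zero_add_armSum_one T ω, hnn 1 ω]
  · exact Filter.Eventually.of_forall (hnn 0)

/-- In the environment `(θ₁, θ₂)`, arm `1` is played at most `K log T` times with a probability that
is at least polynomially small in `T`. In the environment `(θ, θ₂)`, where arm `1` is inferior, the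
sum of `1 + |X|` over the rewards `X` of arm `1` is `O(log T)` with probability at least `1 / 2`, and
on this event the log-likelihood ratio between the two environments is `O(log T)`. -/
lemma exists_exp_log_le_trajLaw (hπ : LabelInvariant M π) (hA1 : IsOptimized M π)
    {θ₁ θ₂ θ : M.paramSpace} (hθ : (θ : ℝ) < θ₂) (hint : (θ : ℝ) ∈ interior M.paramSpace) :
    ∃ C K : ℝ, ∀ᶠ T : ℕ in Filter.atTop,
      Real.exp (-(C * Real.log T)) / 2 ≤
        (π.trajLaw (M.env θ₁ θ₂)).real {ω | armSum 0 (fun _ => 1) T ω ≤ K * Real.log T} := by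
  obtain ⟨K₀, hK₀, hev⟩ := M.exists_lintegral_armSum_le_log π hπ hA1 hθ
  set Δ := M.logNormalizer θ - M.logNormalizer θ₁
  -- `C₀ * (1 + |x|)` bounds the log-likelihood ratio of a single reward `x`.
  let C₀ := |(θ : ℝ) - θ₁| + |Δ|
  have hC₀ : 0 ≤ C₀ := by positivity
  have hgi : Integrable (fun x => 1 + |x|) (M.law θ) :=
    (integrable_const 1).add (M.integrable_id_law hint).abs
  let m := ∫ x, (1 + |x|) ∂(M.law θ)
  have hm : 1 ≤ m := by
    have : ∫ _, (1 : ℝ) ∂(M.law θ) ≤ m :=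
      integral_mono (integrable_const 1) hgi fun x => by simp
    simpa using this
  have hm' : ∫⁻ x, ENNReal.ofReal (1 + |x|) ∂(M.law θ) = ENNReal.ofReal m :=
    (ofReal_integral_eq_lintegral_ofReal hgi
      (Filter.Eventually.of_forall fun x => by positivity)).symm
  refine ⟨C₀ * (2 * m * K₀), 2 * m * K₀, ?_⟩
  filter_upwards [hev, Filter.eventually_gt_atTop 1] with T hN hT
  have hlog : 0 < Real.log T := Real.log_pos (by exact_mod_cast hT)
  set R := 2 * m * K₀ * Real.log T with hR
  have hRpos : 0 < R := by positivity
  let L := armSum 0 (fun x => 1 + |x|) T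
  have hLm : Measurable L := measurable_armSum 0 (by fun_prop) T
  let G : Set (ℕ → Fin 2 × ℝ) := {ω | L ω < R}
  have hGm : MeasurableSet G := measurableSet_lt hLm measurable_const
  have hGT : DependsOn (· ∈ G) (Set.Iio T) := by
    intro ω ω' h
    simp only [G, L, Set.mem_ofPred_eq, dependsOn_armSum 0 (fun x => 1 + |x|) T h]
  -- Wald's identity and Markov's inequality; the factor `2` in `R` gives the probability `1 / 2`.
  have hmarkov : (π.trajLaw (M.env θ θ₂)).real Gᶜ ≤ 1 / 2 := by
    have h1 : ∫⁻ ω, ENNReal.ofReal (L ω) ∂(π.trajLaw (M.env θ θ₂)) ≤ ENNReal.ofReal (R / 2) := by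
      rw [π.lintegral_armSum _ 0 (g := fun x => 1 + |x|) (by fun_prop) (fun x => by positivity)]
      have : M.env θ θ₂ 0 = M.law θ := rfl
      rw [this, hm']
      refine (mul_le_mul_right hN _).trans_eq ?_
      rw [← ENNReal.ofReal_mul (by positivity)]
      congr 1
      rw [hR]; ring
    have h2 : ENNReal.ofReal R * (π.trajLaw (M.env θ θ₂)) Gᶜ ≤ ENNReal.ofReal (R / 2) := by
      refine le_trans ?_ ((mul_meas_ge_le_lintegral hLm.ennreal_ofReal (ENNReal.ofReal R)).trans h1)
      refine mul_le_mul_right (measure_mono fun ω hω => ?_) _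
      exact ENNReal.ofReal_le_ofReal (not_lt.mp hω)
    have h3 := ENNReal.toReal_mono ENNReal.ofReal_ne_top h2
    rw [ENNReal.toReal_mul, ENNReal.toReal_ofReal hRpos.le,
      ENNReal.toReal_ofReal (by positivity)] at h3
    change R * (π.trajLaw (M.env θ θ₂)).real Gᶜ ≤ R / 2 at h3
    nlinarith
  have hG : 1 / 2 ≤ (π.trajLaw (M.env θ θ₂)).real G := by
    rw [probReal_compl_eq_one_sub hGm] at hmarkov
    linarith
  have hcm := π.trajLaw_apply_eq_setLIntegral_armSum (M.env θ₁ θ₂) (M.env θ θ₂) 0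
    (g := fun x => ((θ : ℝ) - θ₁) * x - Δ) (by fun_prop)
    (by simpa [env, Δ] using M.law_eq_withDensity_law θ₁ θ)
    (by intro j hj; fin_cases j <;> simp_all [env]) (by omega) hGm hGT
  have hle : (π.trajLaw (M.env θ θ₂)) G ≤
      ENNReal.ofReal (Real.exp (C₀ * R)) * (π.trajLaw (M.env θ₁ θ₂)) G := by
    rw [hcm]
    calc _ ≤ ∫⁻ ω in G, ENNReal.ofReal (Real.exp (C₀ * R)) ∂(π.trajLaw (M.env θ₁ θ₂)) := by
          refine setLIntegral_mono' hGm fun ω hω =>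
            ENNReal.ofReal_le_ofReal (Real.exp_le_exp.mpr ?_)
          calc _ ≤ armSum 0 (fun x => C₀ * (1 + |x|)) T ω := by
                refine armSum_mono 0 (fun x => ?_) T ω
                have h1 := abs_mul ((θ : ℝ) - θ₁) x ▸ le_abs_self (((θ : ℝ) - θ₁) * x)
                have h2 := neg_abs_le Δ
                have h3 : 0 ≤ |Δ| * |x| := by positivity
                have h4 := abs_nonneg ((θ : ℝ) - θ₁)
                simp only [C₀]
                nlinarith
            _ = C₀ * L ω := by simp only [L, armSum, Finset.mul_sum]
            _ ≤ C₀ * R := mul_le_mul_of_nonneg_left (le_of_lt hω) hC₀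
      _ = _ := by simp
  have h3 := ENNReal.toReal_mono (ENNReal.mul_ne_top ENNReal.ofReal_ne_top
    (measure_ne_top _ _)) hle
  rw [ENNReal.toReal_mul, ENNReal.toReal_ofReal (Real.exp_pos _).le] at h3
  change (π.trajLaw (M.env θ θ₂)).real G ≤
    Real.exp (C₀ * R) * (π.trajLaw (M.env θ₁ θ₂)).real G at h3
  have hsub : (π.trajLaw (M.env θ₁ θ₂)).real G ≤ (π.trajLaw (M.env θ₁ θ₂)).real
      {ω | armSum 0 (fun _ => 1) T ω ≤ 2 * m * K₀ * Real.log T} := by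
    refine measureReal_mono fun ω hω => ?_
    have h4 := armSum_mono 0 (f := fun _ => 1) (g := fun x => 1 + |x|) (by simp) T ω
    exact h4.trans (le_of_lt hω)
  refine le_trans ?_ hsub
  have h5 : C₀ * (2 * m * K₀) * Real.log T = C₀ * R := by rw [hR]; ring
  rw [h5, Real.exp_neg, div_le_iff₀ two_pos, inv_le_iff_one_le_mul₀ (Real.exp_pos _)]
  linarith

end ExpFamily

/-! ### Concentration given many plays of the inferior arm -/

theorem proposition8 (M : ExpFamily) (π : BanditAlgorithm)
    (hπ : LabelInvariant M π) (hA1 : IsOptimized M π)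
    (θ₁ θ₂ : M.paramSpace) (hθ : (θ₂ : ℝ) < θ₁)
    (hmin : ∃ θ : M.paramSpace, (θ : ℝ) < θ₂)
    (γ : ℝ) (hγ : γ ∈ Set.Ioo (0 : ℝ) 1) (ε : ℝ) (hε : 0 < ε) :
    ∀ δ : ℝ, 0 < δ → ∀ᶠ T : ℕ in Filter.atTop,
      ∀ x ∈ Set.Icc ((T : ℝ) ^ γ) ((1 - γ) * (T : ℝ)),
        0 < (π.trajLaw (M.env θ₁ θ₂)).real {ω | x ≤ (numPlays 1 T ω : ℝ)} ∧
        |(ProbabilityTheory.cond (π.trajLaw (M.env θ₁ θ₂))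
            {ω | x ≤ (numPlays 1 T ω : ℝ)}).real
            {ω | |sampleMean 1 T ω - M.mean θ₂| ≤ ε} - 1| < δ := by
  intro δ hδ
  obtain ⟨θ₀, hθ₀⟩ := hmin
  have h₂ : (θ₂ : ℝ) ∈ interior M.paramSpace :=
    M.mem_interior_paramSpace θ₀.2 θ₁.2 hθ₀ hθ
  obtain ⟨t, ht0, ht2⟩ := exists_between hθ₀
  have ht : t ∈ interior M.paramSpace := M.mem_interior_paramSpace θ₀.2 θ₂.2 ht0 ht2
  let θ : M.paramSpace := ⟨t, interior_subset ht⟩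
  obtain ⟨c₁, hc₁, hup⟩ := M.exists_trajLaw_le_exp π (θ₁ := θ₁) h₂ hε 1
  obtain ⟨c₂, hc₂, hdown⟩ := M.exists_trajLaw_le_exp π (θ₁ := θ₁) h₂ hε (-1)
  obtain ⟨C, K, hlow⟩ := M.exists_exp_log_le_trajLaw π hπ hA1 (θ₁ := θ₁) (θ₂ := θ₂) (θ := θ) ht2 ht
  set P := π.trajLaw (M.env θ₁ θ₂)
  let c := min c₁ c₂
  have hc : 0 < c := lt_min hc₁ hc₂
  -- For large `T`, at most `K log T` plays of arm `1` leave at least `(1 - γ) T` plays of arm `2`.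
  have hcast := tendsto_natCast_atTop_atTop (R := ℝ)
  have hA : ∀ᶠ T : ℕ in Filter.atTop, K * Real.log T ≤ γ * T := by
    have h := (Real.isLittleO_log_id_atTop.const_mul_left K).def hγ.1
    filter_upwards [hcast.eventually h] with T hT
    have := (le_abs_self _).trans hT
    simpa using this
  -- `exp (-c T ^ γ)` is negligible against the polynomial `T ^ (-C)`.
  have hB : ∀ᶠ T : ℕ in Filter.atTop,
      4 * Real.exp (C * Real.log T - c * (T : ℝ) ^ γ) < δ := by
    have h1 : ∀ᶠ y : ℝ in Filter.atTop, C * Real.log y - c * y ^ γ ≤ -(c / 2) * y ^ γ := by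
      have h := ((isLittleO_log_rpow_atTop hγ.1).const_mul_left C).def (half_pos hc)
      filter_upwards [h, Filter.eventually_ge_atTop 0] with y hy hy0
      have h2 := (le_abs_self _).trans hy
      rw [Real.norm_of_nonneg (Real.rpow_nonneg hy0 γ)] at h2
      linarith
    have h2 : Filter.Tendsto (fun y : ℝ => 4 * Real.exp (-(c / 2) * y ^ γ)) Filter.atTop
        (nhds 0) := by
      have h3 := (tendsto_rpow_atTop hγ.1).const_mul_atTop_of_neg
        (show -(c / 2) < 0 by linarith)
      simpa using (Real.tendsto_exp_atBot.comp h3).const_mul 4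
    filter_upwards [hcast.eventually h1, hcast.eventually (h2.eventually_lt_const hδ)] with T h4 h5
    exact lt_of_le_of_lt (by gcongr) h5
  filter_upwards [hlow, hA, hB, Filter.eventually_gt_atTop 0] with T hlowT hAT hBT hT x hx
  have hTr : (0 : ℝ) < T := by exact_mod_cast hT
  -- `x > 0`, so that no sample mean below is the junk value of a division by zero.
  have hxpos : 0 < x := lt_of_lt_of_le (Real.rpow_pos_of_pos hTr γ) hx.1
  simp only [natCast_numPlays_eq_armSum, sampleMean_eq_armSum_div]
  set N := armSum 1 (fun _ => 1) T
  set S := armSum 1 (fun x => x) T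
  have mN : Measurable N := measurable_armSum 1 measurable_const T
  have mS : Measurable S := measurable_armSum 1 measurable_id T
  have hEm : MeasurableSet {ω | x ≤ N ω} := measurableSet_le measurable_const mN
  have hgm : MeasurableSet {ω | |S ω / N ω - M.mean θ₂| ≤ ε} :=
    measurableSet_le ((mS.div mN).sub_const _).abs measurable_const
  have hE : Real.exp (-(C * Real.log T)) / 2 ≤ P.real {ω | x ≤ N ω} := by
    refine hlowT.trans (measureReal_mono fun ω hω => ?_)
    have h1 : armSum 0 (fun _ => 1) T ω ≤ K * Real.log T := hω
    have h2 := armSum_zero_add_armSum_one T ω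
    have h3 := hx.2
    change x ≤ armSum 1 (fun _ => 1) T ω
    linarith
  have hEpos : 0 < P.real {ω | x ≤ N ω} := lt_of_lt_of_le (by positivity) hE
  refine ⟨hEpos, ?_⟩
  have hbad : P.real ({ω | x ≤ N ω} ∩ {ω | |S ω / N ω - M.mean θ₂| ≤ ε}ᶜ) ≤
      2 * Real.exp (-(c * (T : ℝ) ^ γ)) := by
    have hsub : {ω | x ≤ N ω} ∩ {ω | |S ω / N ω - M.mean θ₂| ≤ ε}ᶜ ⊆
        {ω | x ≤ N ω ∧ ε * N ω ≤ 1 * (S ω - M.mean θ₂ * N ω)} ∪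
        {ω | x ≤ N ω ∧ ε * N ω ≤ -1 * (S ω - M.mean θ₂ * N ω)} := by
      rintro ω ⟨h1, h2⟩
      have h1 : x ≤ N ω := h1
      have hN : 0 < N ω := hxpos.trans_le h1
      have h2 : ε < |S ω / N ω - M.mean θ₂| := not_le.mp h2
      rcases lt_abs.mp h2 with h | h
      · left
        rw [lt_sub_iff_add_lt, lt_div_iff₀ hN] at h
        exact ⟨h1, by linarith⟩
      · right
        rw [neg_sub, lt_sub_comm, div_lt_iff₀ hN] at h
        exact ⟨h1, by linarith⟩
    have hexp : ∀ d, c ≤ d → Real.exp (-(d * x)) ≤ Real.exp (-(c * (T : ℝ) ^ γ)) := by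
      intro d hd
      refine Real.exp_le_exp.mpr (neg_le_neg ?_)
      exact mul_le_mul hd hx.1 (Real.rpow_nonneg hTr.le γ) (hc.le.trans hd)
    calc _ ≤ _ := measureReal_mono hsub
      _ ≤ _ := measureReal_union_le _ _
      _ ≤ _ := add_le_add ((hup T hT x).trans (hexp c₁ (min_le_left _ _)))
          ((hdown T hT x).trans (hexp c₂ (min_le_right _ _)))
      _ = _ := by ring
  have : IsProbabilityMeasure (cond P {ω | x ≤ N ω}) :=
    cond_isProbabilityMeasure fun h => by simp [measureReal_def, h] at hEpos
  have hcompl := probReal_compl_eq_one_sub (μ := cond P {ω | x ≤ N ω}) hgm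
  rw [abs_sub_comm, ← hcompl, abs_of_nonneg measureReal_nonneg, measureReal_def,
    cond_apply hEm, ENNReal.toReal_mul, ENNReal.toReal_inv, ← measureReal_def, ← measureReal_def,
    inv_mul_lt_iff₀ hEpos]
  calc _ ≤ _ := hbad
    _ = Real.exp (-(C * Real.log T)) / 2 * (4 * Real.exp (C * Real.log T - c * (T : ℝ) ^ γ)) := by
      rw [sub_eq_add_neg, Real.exp_add, Real.exp_neg (C * Real.log T)]
      field_simp
      ring
    _ < Real.exp (-(C * Real.log T)) / 2 * δ := by gcongr
    _ ≤ _ := by gcongr
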